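/- For an integer $n\ge 0$, let $Q_n$ be the $n$-dimensional hypercube: its vertices are the $n$-bit binary strings, and two of them are adjacent when they differ in exactly one position. A $k$-dimensional subcube of $Q_n$ is a vertex set $U\subseteq V(Q_n)$ whose induced subgraph is isomorphic to $Q_k$. For $m\ge 0$, let an $m$-family be a finite set $\mathcal F$ of pairwise vertex-disjoint subcubes of $Q_n$, each of dimension at most $m$, and let $Q_n-\mathcal F$ be the subgraph of $Q_n$ induced by the vertices that lie in no member of $\mathcal F$. The $Q_m$-subcube connectivity $\kappa^{sc}(Q_n;Q_m)$ is the minimum cardinality of an $m$-family $\mathcal F$ such that $Q_n-\mathcal F$ is disconnected. The $Q_m$-subcube fault diameter is $$D^{sc}_f(Q_n;Q_m)=\max\{\operatorname{diam}(Q_n-\mathcal F) : \mathcal F \text{ an } m\text{-family},\ |\mathcal F|\le \kappa^{sc}(Q_n;Q_m)-1\}.$$ **Theorem.** Let $m\ge 0$ and $n\ge m+3$. Then $\kappa^{sc}(Q_n;Q_m)=n-m$ and $D^{sc}_f(Q_n;Q_m)=n+1$. Thus $n+1$ is the largest diameter of a graph obtained from $Q_n$ by removing at most $n-m-1$ pairwise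 vertex-disjoint subcubes of dimension at most $m$. -/

import Mathlib

/-- The `n`-dimensional hypercube `Q_n`: vertices are the `n`-bit strings, and two of them are
adjacent when they differ in exactly one position. -/
def hypercube (n : ℕ) : SimpleGraph (Fin n → Bool) where
  Adj x y := hammingDist x y = 1
  symm := ⟨fun x y h => by rw [hammingDist_comm]; exact h⟩
  loopless := ⟨fun x h => by simp at h⟩

/-- `S_k(Q_n)`: the vertex set `U` spans a `k`-dimensional subcube of `Q_n`, i.e. the subgraph of
`Q_n` induced by `U` is isomorphic to `Q_k`. -/
def IsSubcube (n k : ℕ) (U : Finset (Fin n → Bool)) : Prop :=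
  Nonempty ((hypercube n).induce (U : Set (Fin n → Bool)) ≃g hypercube k)

/-- `F` is a set of pairwise vertex-disjoint subcubes of `Q_n`, each of dimension at most `m`. -/
def IsSubcubeFamily (n m : ℕ) (F : Finset (Finset (Fin n → Bool))) : Prop :=
  (∀ U ∈ F, ∃ k ≤ m, IsSubcube n k U) ∧ ∀ U ∈ F, ∀ W ∈ F, U ≠ W → Disjoint U W

/-- `Q_n - F`: the subgraph of `Q_n` induced by the vertices lying in no member of `F`. -/
def removeFamily (n : ℕ) (F : Finset (Finset (Fin n → Bool))) :
    SimpleGraph {x : Fin n → Bool | ∀ U ∈ F, x ∉ U} :=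
  (hypercube n).induce {x : Fin n → Bool | ∀ U ∈ F, x ∉ U}

/-- The `Q_m`-subcube connectivity `κ^{sc}(Q_n; Q_m)`: the least number of pairwise vertex-disjoint
subcubes of dimension at most `m` whose removal disconnects `Q_n` (`⊤` if there is no such set). -/
noncomputable def subcubeConnectivity (n m : ℕ) : ℕ∞ :=
  ⨅ (F : Finset (Finset (Fin n → Bool)))
    (_ : IsSubcubeFamily n m F ∧ ¬ (removeFamily n F).Preconnected), (F.card : ℕ∞)

/-- The `Q_m`-subcube fault diameter `D_f^{sc}(Q_n; Q_m)`: the largest diameter of a graph obtained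
from `Q_n` by removing fewer than `κ^{sc}(Q_n; Q_m)` pairwise vertex-disjoint subcubes of dimension
at most `m`. Diameters are extended (`⊤` for a disconnected graph), so nothing is hidden by a
default value. -/
noncomputable def subcubeFaultDiam (n m : ℕ) : ℕ∞ :=
  ⨆ (F : Finset (Finset (Fin n → Bool)))
    (_ : IsSubcubeFamily n m F ∧ (F.card : ℕ∞) < subcubeConnectivity n m),
    (removeFamily n F).ediam

/-! Upper bound. Encode a vertex by the set of coordinates where it differs from `x`. Then `x` is
`∅`, `y` is a set `D`, and a removed subcube, being a coordinate cube
(`IsSubcube.exists_eq_coordCube`), is an interval `[A, B]` with at most `m` elements in `B \ A`.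
`exists_detour_avoiding` finds `T` disjoint from `D` and monotone chains `∅ → T → D ∪ T ← D` missing
all intervals. The route has length `|D| + 2|T|`, and `2|T| ≤ |Dᶜ| + 1` makes this at most `n + 1`.
The engine is `exists_chain_avoiding`, an induction shortening the interval `[X, Y]` from either
end.

Finite distances also show that fewer than `n - m` subcubes cannot disconnect, so this bound gives
the lower bound on connectivity too.

Sharpness. Let `C` be the cube on the first `m` coordinates. Removing its `n - m` neighbouring
translates isolates it. If one translate is kept, in direction `e`, a path from `0` to the vertex
that is `1` everywhere except at `e` must leave `C` through `e` and later undo that flip: `(n - 1) +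
2` steps. -/

/-! ### Monotone chains in the Boolean lattice that avoid intervals. -/

section IntervalAvoidance

variable {α ι : Type*} [DecidableEq α]

/-- One step up the Boolean lattice between two finsets satisfying `P`. -/
def StepUp (P : Finset α → Prop) (S T : Finset α) : Prop :=
  P S ∧ P T ∧ ∃ a, a ∉ S ∧ T = insert a S

/-- `S` lies in none of the intervals `[A j, B j]`, `j ∈ K`. -/
def Avoids (A B : ι → Finset α) (K : Finset ι) (S : Finset α) : Prop :=
  ∀ j ∈ K, ¬ (A j ⊆ S ∧ S ⊆ B j)

lemma StepUp.subset {P : Finset α → Prop} {S T : Finset α}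
    (h : Relation.ReflTransGen (StepUp P) S T) : S ⊆ T := by
  induction h with
  | refl => exact subset_rfl
  | tail _ h ih =>
    obtain ⟨-, -, a, -, rfl⟩ := h
    exact ih.trans (Finset.subset_insert _ _)

/-- Every set on the chain lies between its ends, so the predicates need comparing only there. This
lets a chain built for a subfamily of intervals serve for the whole family, once the discarded
intervals miss `[S, T]`. -/
lemma StepUp.chain_mono {P Q : Finset α → Prop} {S T : Finset α}
    (h : Relation.ReflTransGen (StepUp P) S T) (hPQ : ∀ U, S ⊆ U → U ⊆ T → P U → Q U) :
    Relation.ReflTransGen (StepUp Q) S T := by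
  induction h with
  | refl => exact .refl
  | @tail U V hU h ih =>
    obtain ⟨h1, h2, a, ha, rfl⟩ := h
    have hs := StepUp.subset hU
    refine (ih fun W h3 h4 => hPQ W h3 (h4.trans (Finset.subset_insert _ _))).tail
      ⟨hPQ _ hs (Finset.subset_insert _ _) h1,
        hPQ _ (hs.trans (Finset.subset_insert _ _)) subset_rfl h2, a, ha, rfl⟩

lemma StepUp.chain_of_forall {P : Finset α → Prop} {S T : Finset α} (hST : S ⊆ T)
    (hP : ∀ U, S ⊆ U → U ⊆ T → P U) : Relation.ReflTransGen (StepUp P) S T := by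
  induction hk : (T \ S).card generalizing S with
  | zero =>
    have : T ⊆ S := by simpa [Finset.sdiff_eq_empty_iff_subset] using hk
    rw [hST.antisymm this]
  | succ k ih =>
    obtain ⟨a, ha⟩ := Finset.card_pos.mp (by omega : 0 < (T \ S).card)
    have ha' := Finset.mem_sdiff.mp ha
    have hsub : insert a S ⊆ T := Finset.insert_subset ha'.1 hST
    refine .head ⟨hP S subset_rfl hST, hP _ (Finset.subset_insert _ _) hsub, a, ha'.2, rfl⟩
      (ih hsub (fun U h1 h2 => hP U ((Finset.subset_insert _ _).trans h1) h2) ?_)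
    have : T \ insert a S = (T \ S).erase a := by ext; simp; tauto
    rw [this, Finset.card_erase_of_mem ha]; omega

/-- If fewer than `|Y \ X| - dim` intervals of the Boolean lattice, all meeting `[X, Y]`, miss `X`
and `Y`, then some maximal chain from `X` to `Y` avoids all of them. -/
theorem exists_chain_avoiding (A B : ι → Finset α) (hAB : ∀ j, A j ⊆ B j) (K : Finset ι)
    {X Y : Finset α} (hXY : X ⊆ Y) (hX : Avoids A B K X) (hY : Avoids A B K Y)
    (hAY : ∀ j ∈ K, A j ⊆ Y) (hXB : ∀ j ∈ K, X ⊆ B j)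
    (hcard : ∀ j ∈ K, ((B j ∩ Y) \ (A j ∪ X)).card + K.card + 1 ≤ (Y \ X).card) :
    Relation.ReflTransGen (StepUp (Avoids A B K)) X Y := by
  classical
  induction hN : (Y \ X).card using Nat.strong_induction_on generalizing X Y K with
  | _ N IH =>
  subst hN
  rcases K.eq_empty_or_nonempty with rfl | hK
  · exact StepUp.chain_of_forall hXY fun U _ _ j hj => by simp at hj
  obtain ⟨j₀, hj₀⟩ := hK
  -- an admissible first step
  have up : ∀ a ∈ Y \ X, Avoids A B K (insert a X) →
      ((∃ j ∈ K, a ∉ B j) ∨ ∀ j ∈ K, a ∉ A j) →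
      Relation.ReflTransGen (StepUp (Avoids A B K)) X Y := by
    intro a ha hav hcase
    obtain ⟨haY, haX⟩ := Finset.mem_sdiff.mp ha
    have hsub : insert a X ⊆ Y := Finset.insert_subset haY hXY
    have hdiff : Y \ insert a X = (Y \ X).erase a := by ext; simp; tauto
    have hdc : (Y \ insert a X).card + 1 = (Y \ X).card := by
      rw [hdiff, Finset.card_erase_add_one ha]
    -- All later sets contain `a`, so intervals with `a ∉ B j` can be discarded.
    have key := IH _ (by omega) (K.filter fun j => a ∈ B j) hsub
      (fun j hj => hav j (Finset.mem_filter.mp hj).1)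
      (fun j hj => hY j (Finset.mem_filter.mp hj).1)
      (fun j hj => hAY j (Finset.mem_filter.mp hj).1)
      (fun j hj => Finset.insert_subset (Finset.mem_filter.mp hj).2
        (hXB j (Finset.mem_filter.mp hj).1)) ?_ rfl
    · refine .head ⟨hX, hav, a, haX, rfl⟩ (StepUp.chain_mono key ?_)
      intro U h1 _ hU j hj hjU
      exact hU j (Finset.mem_filter.mpr
        ⟨hj, hjU.2 (h1 (Finset.mem_insert_self _ _))⟩) hjU
    · intro j hj
      obtain ⟨hjK, haB⟩ := Finset.mem_filter.mp hj
      have h0 := hcard j hjK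
      have hle : (K.filter fun j => a ∈ B j).card ≤ K.card := Finset.card_filter_le _ _
      have hsubd : (B j ∩ Y) \ (A j ∪ insert a X) ⊆ (B j ∩ Y) \ (A j ∪ X) := by
        intro z; simp; tauto
      -- The loss of one in `|Y \ X|` is repaid either by a discarded interval or by `a` being a
      -- free coordinate of every surviving interval.
      rcases hcase with ⟨i, hi, hai⟩ | hcase
      · have hlt : (K.filter fun j => a ∈ B j).card < K.card :=
          Finset.card_lt_card (Finset.filter_ssubset.mpr ⟨i, hi, hai⟩)
        have := Finset.card_le_card hsubd
        omega
      · have hlt : ((B j ∩ Y) \ (A j ∪ insert a X)).card < ((B j ∩ Y) \ (A j ∪ X)).card := by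
          refine Finset.card_lt_card (Finset.ssubset_iff_of_subset hsubd |>.mpr ⟨a, ?_, ?_⟩)
          · simp [haB, haY, haX, hcase j hjK]
          · simp
        omega
  -- an admissible last step
  have down : ∀ b ∈ Y \ X, Avoids A B K (Y.erase b) →
      ((∃ j ∈ K, b ∈ A j) ∨ ∀ j ∈ K, b ∈ B j) →
      Relation.ReflTransGen (StepUp (Avoids A B K)) X Y := by
    intro b hb hav hcase
    obtain ⟨hbY, hbX⟩ := Finset.mem_sdiff.mp hb
    have hsub : X ⊆ Y.erase b := fun z hz =>
      Finset.mem_erase.mpr ⟨fun h => hbX (h ▸ hz), hXY hz⟩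
    have hdiff : Y.erase b \ X = (Y \ X).erase b := by ext; simp; tauto
    have hdc : (Y.erase b \ X).card + 1 = (Y \ X).card := by
      rw [hdiff, Finset.card_erase_add_one hb]
    have key := IH _ (by omega) (K.filter fun j => b ∉ A j) hsub
      (fun j hj => hX j (Finset.mem_filter.mp hj).1)
      (fun j hj => hav j (Finset.mem_filter.mp hj).1)
      (fun j hj => Finset.subset_erase.mpr ⟨hAY j (Finset.mem_filter.mp hj).1,
        (Finset.mem_filter.mp hj).2⟩)
      (fun j hj => hXB j (Finset.mem_filter.mp hj).1) ?_ rfl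
    · refine .tail (StepUp.chain_mono key ?_)
        ⟨hav, hY, b, Finset.notMem_erase _ _, (Finset.insert_erase hbY).symm⟩
      intro U _ h2 hU j hj hjU
      exact hU j (Finset.mem_filter.mpr
        ⟨hj, fun h => Finset.notMem_erase b Y (h2 (hjU.1 h))⟩) hjU
    · intro j hj
      obtain ⟨hjK, hbA⟩ := Finset.mem_filter.mp hj
      have h0 := hcard j hjK
      have hle : (K.filter fun j => b ∉ A j).card ≤ K.card := Finset.card_filter_le _ _
      have hsubd : (B j ∩ Y.erase b) \ (A j ∪ X) ⊆ (B j ∩ Y) \ (A j ∪ X) := by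
        intro z; simp; tauto
      rcases hcase with ⟨i, hi, hbi⟩ | hcase
      · have hlt : (K.filter fun j => b ∉ A j).card < K.card :=
          Finset.card_lt_card (Finset.filter_ssubset.mpr ⟨i, hi, not_not.mpr hbi⟩)
        have := Finset.card_le_card hsubd
        omega
      · have hlt : ((B j ∩ Y.erase b) \ (A j ∪ X)).card < ((B j ∩ Y) \ (A j ∪ X)).card := by
          refine Finset.card_lt_card (Finset.ssubset_iff_of_subset hsubd |>.mpr ⟨b, ?_, ?_⟩)
          · simp [hbA, hbY, hbX, hcase j hjK]
          · simp
        omega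
  -- Suppose no end can be moved. The only interval that `insert a X` can enter has `A j \ X = {a}`,
  -- and dually the only one that `Y.erase b` can enter has `Y \ B j = {b}`.
  by_contra hno
  have up' : ∀ a ∈ Y \ X, (∀ j ∈ K, ¬ A j \ X = {a}) →
      (∀ j ∈ K, a ∈ B j) ∧ ∃ j ∈ K, a ∈ A j := by
    intro a ha hgood
    by_contra hcon
    refine hno (up a ha ?_ ?_)
    · rintro j hj ⟨h1, h2⟩
      refine hgood j hj (Finset.Subset.antisymm ?_ ?_)
      · intro z hz
        obtain ⟨hz1, hz2⟩ := Finset.mem_sdiff.mp hz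
        exact Finset.mem_singleton.mpr ((Finset.mem_insert.mp (h1 hz1)).resolve_right hz2)
      · rw [Finset.singleton_subset_iff, Finset.mem_sdiff]
        refine ⟨by_contra fun haA => hX j hj ⟨fun z hz => ?_, hXB j hj⟩,
          (Finset.mem_sdiff.mp ha).2⟩
        exact (Finset.mem_insert.mp (h1 hz)).resolve_left fun h => haA (h ▸ hz)
    · by_contra! h
      exact hcon h
  have down' : ∀ b ∈ Y \ X, (∀ j ∈ K, ¬ Y \ B j = {b}) → ∀ j ∈ K, b ∉ A j := by
    intro b hb hgood
    by_contra! hcon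
    refine hno (down b hb ?_ (.inl hcon))
    rintro j hj ⟨h1, h2⟩
    refine hgood j hj (Finset.Subset.antisymm ?_ ?_)
    · intro z hz
      obtain ⟨hz1, hz2⟩ := Finset.mem_sdiff.mp hz
      by_contra hzb
      exact hz2 (h2 (Finset.mem_erase.mpr ⟨by simpa using hzb, hz1⟩))
    · rw [Finset.singleton_subset_iff, Finset.mem_sdiff]
      refine ⟨(Finset.mem_sdiff.mp hb).1, fun hbB => hY j hj ⟨hAY j hj, fun z hz => ?_⟩⟩
      by_cases hzb : z = b
      · exact hzb ▸ hbB
      · exact h2 (Finset.mem_erase.mpr ⟨hzb, hz⟩)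
  set K₁ := K.filter fun j => ∃ a, A j \ X = {a} with hK₁
  set K₂ := K.filter fun j => ∃ b, Y \ B j = {b} with hK₂
  -- A point blocked at neither end would lie in some `A i` by `up'` and in none by `down'`.
  have hcover : Y \ X ⊆ K₁.biUnion (fun j => A j \ X) ∪ K₂.biUnion (fun j => Y \ B j) := by
    intro a ha
    by_cases h1 : ∃ j ∈ K, A j \ X = {a}
    · obtain ⟨j, hj, hja⟩ := h1
      refine Finset.mem_union_left _ (Finset.mem_biUnion.mpr
        ⟨j, Finset.mem_filter.mpr ⟨hj, a, hja⟩, by rw [hja]; simp⟩)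
    · push Not at h1
      obtain ⟨-, i, hi, hai⟩ := up' a ha h1
      by_cases h2 : ∃ j ∈ K, Y \ B j = {a}
      · obtain ⟨j, hj, hja⟩ := h2
        refine Finset.mem_union_right _ (Finset.mem_biUnion.mpr
          ⟨j, Finset.mem_filter.mpr ⟨hj, a, hja⟩, by rw [hja]; simp⟩)
      · push Not at h2
        exact absurd hai (down' a ha h2 i hi)
  have hc₁ : (K₁.biUnion fun j => A j \ X).card ≤ K₁.card := by
    refine (Finset.card_biUnion_le_card_mul _ _ 1 fun j hj => ?_).trans (by simp)
    obtain ⟨a, ha⟩ := (Finset.mem_filter.mp hj).2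
    simp [ha]
  have hc₂ : (K₂.biUnion fun j => Y \ B j).card ≤ K₂.card := by
    refine (Finset.card_biUnion_le_card_mul _ _ 1 fun j hj => ?_).trans (by simp)
    obtain ⟨a, ha⟩ := (Finset.mem_filter.mp hj).2
    simp [ha]
  have hsum : (Y \ X).card ≤ K₁.card + K₂.card :=
    (Finset.card_le_card hcover).trans ((Finset.card_union_le _ _).trans (by omega))
  have hun : (K₁ ∪ K₂).card ≤ K.card :=
    Finset.card_le_card (Finset.union_subset (Finset.filter_subset _ _) (Finset.filter_subset _ _))
  have hint := Finset.card_union_add_card_inter K₁ K₂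
  -- Singletons from `K₁` and `K₂` cover more than `|K|` points, so some interval is counted in
  -- both.
  have hpos : 0 < (K₁ ∩ K₂).card := by
    have := hcard j₀ hj₀
    omega
  obtain ⟨j, hj⟩ := Finset.card_pos.mp hpos
  obtain ⟨hj1, hj2⟩ := Finset.mem_inter.mp hj
  obtain ⟨hjK, a, ha⟩ := Finset.mem_filter.mp hj1
  obtain ⟨-, b, hb⟩ := Finset.mem_filter.mp hj2
  have hbm : b ∈ Y ∧ b ∉ B j := by
    rw [← Finset.mem_sdiff, hb]; simp
  have hbX : b ∉ X := fun h => hbm.2 (hXB j hjK h)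
  have ham : a ∈ A j ∧ a ∉ X := by
    rw [← Finset.mem_sdiff, ha]; simp
  have hab : a ≠ b := fun h => hbm.2 (hAB j (h ▸ ham.1))
  -- Such an interval leaves only `a` and `b` non-free in `Y \ X`, so `hcard` allows no second
  -- interval. Then nothing blocks adding `b`, which escapes `B j`.
  have hK1 : K.card ≤ 1 := by
    have hss : Y \ X ⊆ ((B j ∩ Y) \ (A j ∪ X)) ∪ {a, b} := by
      intro z hz
      obtain ⟨hzY, hzX⟩ := Finset.mem_sdiff.mp hz
      have h1 : z ∈ A j → z = a := fun h => by
        have : z ∈ A j \ X := Finset.mem_sdiff.mpr ⟨h, hzX⟩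
        rw [ha] at this; simpa using this
      have h2 : z ∉ B j → z = b := fun h => by
        have : z ∈ Y \ B j := Finset.mem_sdiff.mpr ⟨hzY, h⟩
        rw [hb] at this; simpa using this
      simp only [Finset.mem_union, Finset.mem_sdiff, Finset.mem_inter, Finset.mem_insert,
        Finset.mem_singleton]
      tauto
    have := (Finset.card_le_card hss).trans (Finset.card_union_le _ _)
    have h2 : ({a, b} : Finset α).card ≤ 2 := Finset.card_le_two
    have := hcard j hjK
    omega
  by_cases hgood : ∀ i ∈ K, ¬ A i \ X = {b}
  · exact hbm.2 ((up' b (Finset.mem_sdiff.mpr ⟨hbm.1, hbX⟩) hgood).1 j hjK)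
  · push Not at hgood
    obtain ⟨i, hi, hib⟩ := hgood
    have : i = j := Finset.card_le_one.mp hK1 i hi j hjK
    subst this
    rw [ha] at hib
    exact hab (Finset.singleton_injective hib)

/-- A small set `T ⊆ J` such that every `B j` containing `T` omits no more points of `J`
than there are indices `j` with `B j` not containing `T`. -/
lemma exists_small_set_of_complements (B : ι → Finset α) (K : Finset ι) (J : Finset α) :
    ∃ T ⊆ J, 2 * T.card ≤ J.card + 1 ∧
      ∀ j ∈ K, T ⊆ B j → (J \ B j).card + (K.filter fun j => T ⊆ B j).card ≤ K.card := by
  classical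
  by_contra! hno
  -- While `T` fails, some violating `B j ⊇ T` omits a point of `J`. Adding that point to `T`
  -- eliminates `j`, so `r` points eliminate at least `r` indices.
  have greedy : ∀ r, 2 * r ≤ J.card + 1 →
      ∃ T ⊆ J, T.card = r ∧ r + (K.filter fun j => T ⊆ B j).card ≤ K.card := by
    intro r
    induction r with
    | zero => exact fun _ => ⟨∅, by simp, by simp, by simp⟩
    | succ r ih =>
      intro hr
      obtain ⟨T, hTJ, hTr, hTK⟩ := ih (by omega)
      obtain ⟨j, hj, hjT, hjlt⟩ := hno T hTJ (by omega)
      have hne : 0 < (J \ B j).card := by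
        have := Finset.card_filter_le K fun j => T ⊆ B j
        omega
      obtain ⟨a, ha⟩ := Finset.card_pos.mp hne
      obtain ⟨haJ, haB⟩ := Finset.mem_sdiff.mp ha
      refine ⟨insert a T, Finset.insert_subset haJ hTJ, ?_, ?_⟩
      · rw [Finset.card_insert_of_notMem fun h => haB (hjT h), hTr]
      · have hlt : (K.filter fun j => insert a T ⊆ B j).card <
            (K.filter fun j => T ⊆ B j).card := by
          refine Finset.card_lt_card ((Finset.ssubset_iff_of_subset ?_).mpr ⟨j, ?_, ?_⟩)
          · intro i hi
            obtain ⟨h1, h2⟩ := Finset.mem_filter.mp hi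
            exact Finset.mem_filter.mpr ⟨h1, (Finset.subset_insert _ _).trans h2⟩
          · exact Finset.mem_filter.mpr ⟨hj, hjT⟩
          · exact fun h => haB ((Finset.mem_filter.mp h).2 (Finset.mem_insert_self _ _))
        omega
  -- At half of `J`, rounded up, a violator omits at most `|J| - |T| ≤ |T|` points, while at least
  -- `|T|` indices are gone: a contradiction.
  obtain ⟨T, hTJ, hTr, hTK⟩ := greedy ((J.card + 1) / 2) (by omega)
  obtain ⟨j, hj, hjT, hjlt⟩ := hno T hTJ (by omega)
  have h1 : J \ B j ⊆ J \ T := Finset.sdiff_subset_sdiff subset_rfl hjT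
  have h2 := Finset.card_le_card h1
  rw [Finset.card_sdiff_of_subset hTJ] at h2
  omega

/-- Routing from `∅` to `D` around few intervals: climb to some `T` disjoint from `D`, then to
`D ∪ T`, then descend to `D`. -/
theorem exists_detour_avoiding (A B : ι → Finset α) (hAB : ∀ j, A j ⊆ B j) (K : Finset ι)
    {D J : Finset α} (hDJ : Disjoint D J) (h0 : Avoids A B K ∅) (hD : Avoids A B K D)
    (hA : ∀ j ∈ K, A j ⊆ D ∪ J)
    (hcard : ∀ j ∈ K, ((B j ∩ (D ∪ J)) \ A j).card + K.card + 1 ≤ D.card + J.card) :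
    ∃ T ⊆ J, 2 * T.card ≤ J.card + 1 ∧
      Relation.ReflTransGen (StepUp (Avoids A B K)) ∅ T ∧
      Relation.ReflTransGen (StepUp (Avoids A B K)) T (D ∪ T) ∧
      Relation.ReflTransGen (StepUp (Avoids A B K)) D (D ∪ T) := by
  classical
  induction hN : J.card generalizing J K with
  | zero =>
    obtain rfl := Finset.card_eq_zero.mp hN
    refine ⟨∅, subset_rfl, by simp, .refl, ?_, by simpa using .refl⟩
    rw [Finset.union_empty] at hcard hA ⊢
    refine exists_chain_avoiding A B hAB K (Finset.empty_subset _) h0 hD hA (by simp) ?_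
    simpa using hcard
  | succ N IH =>
    by_cases hex : ∃ j ∈ K, ∃ i ∈ J, i ∈ A j
    · obtain ⟨j, hj, i, hiJ, hiA⟩ := hex
      have hc := Finset.card_erase_add_one hiJ
      have hiD : i ∉ D := Finset.disjoint_right.mp hDJ hiJ
      have hlt : (K.filter fun j => i ∉ A j).card < K.card :=
        Finset.card_lt_card (Finset.filter_ssubset.mpr ⟨j, hj, not_not.mpr hiA⟩)
      obtain ⟨T, hTJ, hT, c1, c2, c3⟩ := IH (K.filter fun j => i ∉ A j)
        (J := J.erase i) (hDJ.mono_right (Finset.erase_subset _ _))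
        (fun j hj => h0 j (Finset.mem_filter.mp hj).1)
        (fun j hj => hD j (Finset.mem_filter.mp hj).1)
        (fun j hj z hz => by
          obtain ⟨hjK, hjA⟩ := Finset.mem_filter.mp hj
          have hz' := Finset.mem_union.mp (hA j hjK hz)
          have : z ≠ i := fun h => hjA (h ▸ hz)
          simp only [Finset.mem_union, Finset.mem_erase]
          tauto)
        (fun j hj => by
          have h1 := hcard j (Finset.mem_filter.mp hj).1
          have h2 : (B j ∩ (D ∪ J.erase i)) \ A j ⊆ (B j ∩ (D ∪ J)) \ A j := by
            intro z; simp; tauto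
          have := Finset.card_le_card h2
          omega) (by omega)
      have hi : i ∉ D ∪ T := by
        rw [Finset.mem_union]
        rintro (h | h)
        · exact hiD h
        · exact Finset.notMem_erase i J (hTJ h)
      have ext : ∀ U, U ⊆ D ∪ T → Avoids A B (K.filter fun j => i ∉ A j) U → Avoids A B K U :=
        fun U hU hav j hj hjU =>
          hav j (Finset.mem_filter.mpr ⟨hj, fun h => hi (hU (hjU.1 h))⟩) hjU
      exact ⟨T, hTJ.trans (Finset.erase_subset _ _), by omega,
        StepUp.chain_mono c1 fun U _ hU => ext U (hU.trans Finset.subset_union_right),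
        StepUp.chain_mono c2 fun U _ hU => ext U hU,
        StepUp.chain_mono c3 fun U _ hU => ext U hU⟩
    · push Not at hex
      -- Now each `A j` is a nonempty subset of `D` and no `B j` contains `D`. Hence subsets of `J`
      -- and supersets of `D` are all safe, and only the middle leg `T → D ∪ T` needs care.
      have hAD : ∀ j ∈ K, A j ⊆ D := fun j hj z hz =>
        (Finset.mem_union.mp (hA j hj hz)).resolve_right fun h => hex j hj z h hz
      have hBD : ∀ j ∈ K, ¬ D ⊆ B j := fun j hj h => hD j hj ⟨hAD j hj, h⟩
      have hlow : ∀ U, U ⊆ J → Avoids A B K U := by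
        intro U hU j hj hjU
        refine h0 j hj ⟨fun z hz => ?_, Finset.empty_subset _⟩
        exact absurd hz (hex j hj z (hU (hjU.1 hz)))
      have hhigh : ∀ U, D ⊆ U → Avoids A B K U := fun U hU j hj hjU =>
        hBD j hj (hU.trans hjU.2)
      obtain ⟨T, hTJ, hT, hTK⟩ := exists_small_set_of_complements B K J
      have hDT : Disjoint D T := hDJ.mono_right hTJ
      refine ⟨T, hTJ, by omega, StepUp.chain_of_forall (Finset.empty_subset _)
        fun U _ hU => hlow U (hU.trans hTJ), ?_,
        StepUp.chain_of_forall Finset.subset_union_left fun U hU _ => hhigh U hU⟩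
      have hdiff : (D ∪ T) \ T = D := by
        rw [Finset.union_sdiff_right, Finset.sdiff_eq_self_of_disjoint hDT]
      have key := exists_chain_avoiding A B hAB (K.filter fun j => T ⊆ B j)
        (X := T) (Y := D ∪ T) Finset.subset_union_right
        (fun j hj => hlow T hTJ j (Finset.mem_filter.mp hj).1)
        (fun j hj => hhigh _ Finset.subset_union_left j (Finset.mem_filter.mp hj).1)
        (fun j hj => (hAD j (Finset.mem_filter.mp hj).1).trans Finset.subset_union_left)
        (fun j hj => (Finset.mem_filter.mp hj).2)
        (fun j hj => by
          obtain ⟨hjK, hjT⟩ := Finset.mem_filter.mp hj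
          have h1 := hcard j hjK
          have h2 := hTK j hjK hjT
          -- On the middle leg the free coordinates in `B j ∩ J` no longer count. The choice of `T`
          -- makes this saving, with the drop in the number of intervals, at least `|J|`.
          have h3 : ((B j ∩ (D ∪ T)) \ (A j ∪ T)).card + (B j ∩ J).card ≤
              ((B j ∩ (D ∪ J)) \ A j).card := by
            rw [← Finset.card_union_of_disjoint]
            · refine Finset.card_le_card fun z => ?_
              have := hex j hjK z
              simp only [Finset.mem_union, Finset.mem_sdiff, Finset.mem_inter]
              tauto
            · refine Finset.disjoint_left.mpr fun z hz hz' => ?_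
              have : z ∈ D → z ∉ J := fun h => Finset.disjoint_left.mp hDJ h
              simp only [Finset.mem_union, Finset.mem_sdiff, Finset.mem_inter] at hz hz'
              tauto
          have h4 := Finset.card_sdiff_add_card_inter J (B j)
          rw [Finset.inter_comm] at h4
          rw [hdiff]
          omega)
      refine StepUp.chain_mono key fun U hTU _ hU j hj hjU => ?_
      exact hU j (Finset.mem_filter.mpr ⟨hj, hTU.trans hjU.2⟩) hjU

end IntervalAvoidance

/-! ### Induced copies of `Q_k` are exactly the coordinate cubes. -/

section Subcubes

variable {n : ℕ}

/-- The points agreeing with `p` outside `R`. -/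
def coordCube (p : Fin n → Bool) (R : Finset (Fin n)) : Finset (Fin n → Bool) :=
  Finset.univ.filter fun z => ∀ i ∉ R, z i = p i

lemma mem_coordCube {p z : Fin n → Bool} {R : Finset (Fin n)} :
    z ∈ coordCube p R ↔ ∀ i ∉ R, z i = p i := by
  simp [coordCube]

lemma hypercube_adj_iff {x y : Fin n → Bool} :
    (hypercube n).Adj x y ↔ ∃ i, x i ≠ y i ∧ ∀ j, j ≠ i → x j = y j := by
  change hammingDist x y = 1 ↔ _
  rw [hammingDist, Finset.card_eq_one]
  constructor
  · rintro ⟨i, hi⟩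
    have h := fun j => Finset.ext_iff.mp hi j
    simp only [Finset.mem_filter, Finset.mem_univ, true_and, Finset.mem_singleton] at h
    exact ⟨i, (h i).mpr rfl, fun j hj => by_contra fun hc => hj ((h j).mp hc)⟩
  · rintro ⟨i, hi, h⟩
    refine ⟨i, ?_⟩
    ext j
    simp only [Finset.mem_filter, Finset.mem_univ, true_and, Finset.mem_singleton]
    exact ⟨fun hj => by_contra fun hc => hj (h j hc), fun hj => hj ▸ hi⟩

/-- A point with two distinct neighbours in a coordinate cube lies in it. -/
lemma mem_coordCube_of_adj {p a b c : Fin n → Bool} {R : Finset (Fin n)}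
    (ha : a ∈ coordCube p R) (hb : b ∈ coordCube p R) (hab : a ≠ b)
    (hca : (hypercube n).Adj c a) (hcb : (hypercube n).Adj c b) : c ∈ coordCube p R := by
  rw [mem_coordCube] at *
  obtain ⟨s, hs, hs'⟩ := hypercube_adj_iff.mp hca
  obtain ⟨t, ht, ht'⟩ := hypercube_adj_iff.mp hcb
  intro i hi
  by_contra hne
  have his : i = s := by
    by_contra h
    exact hne ((hs' i h).trans (ha i hi))
  have hit : i = t := by
    by_contra h
    exact hne ((ht' i h).trans (hb i hi))
  subst his
  subst hit
  refine hab (funext fun j => ?_)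
  by_cases hj : j = i
  · subst hj
    rw [ha j hi, hb j hi]
  · rw [← hs' j hj, ht' j hj]

lemma card_coordCube_le (p : Fin n → Bool) (R : Finset (Fin n)) :
    (coordCube p R).card ≤ 2 ^ R.card := by
  have : (coordCube p R).card ≤ (Finset.univ : Finset (R → Bool)).card := by
    refine Finset.card_le_card_of_injOn (fun z i => z i) (fun _ _ => by simp) ?_
    intro z hz w hw hzw
    rw [Finset.mem_coe, mem_coordCube] at hz hw
    funext i
    by_cases hi : i ∈ R
    · exact congrFun hzw ⟨i, hi⟩
    · rw [hz i hi, hw i hi]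
  simpa using this

/-- Every induced copy of `Q_k` in `Q_n` is a coordinate cube. -/
theorem IsSubcube.exists_eq_coordCube {k : ℕ} {U : Finset (Fin n → Bool)} (h : IsSubcube n k U) :
    ∃ (p : Fin n → Bool) (R : Finset (Fin n)), R.card ≤ k ∧ U = coordCube p R := by
  classical
  obtain ⟨e⟩ := h
  let ind : Finset (Fin k) → (Fin k → Bool) := fun s i => decide (i ∈ s)
  let g : Finset (Fin k) → (Fin n → Bool) := fun s => (e.symm (ind s)).1
  have hind : Function.Injective ind := fun s t hst => by
    ext i
    simpa [ind] using congrFun hst i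
  have hg : Function.Injective g := fun s t hst =>
    hind (e.symm.injective (Subtype.ext hst))
  have hadj : ∀ s, ∀ i ∈ s, (hypercube n).Adj (g s) (g (s.erase i)) := by
    intro s i hi
    have : (hypercube k).Adj (ind s) (ind (s.erase i)) := by
      refine hypercube_adj_iff.mpr ⟨i, by simp [ind, hi], fun j hj => by simp [ind, hj]⟩
    exact e.symm.map_rel_iff.mpr this
  have hflip : ∀ i : Fin k, ∃ c, ∀ j, j ≠ c → g {i} j = g ∅ j := by
    intro i
    obtain ⟨c, -, hc⟩ := hypercube_adj_iff.mp (hadj {i} i (by simp))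
    exact ⟨c, fun j hj => by simpa using hc j hj⟩
  choose c hc using hflip
  refine ⟨g ∅, Finset.univ.image c, Finset.card_image_le.trans (by simp), ?_⟩
  -- The singletons fix the directions. A larger `s` has two distinct neighbours `s.erase i`,
  -- `s.erase j` already in the cube, which forces it in. Counting `2 ^ k` points then gives
  -- equality.
  have hmem : ∀ s, g s ∈ coordCube (g ∅) (Finset.univ.image c) := by
    intro s
    induction hs : s.card using Nat.strong_induction_on generalizing s with
    | _ N IH =>
    subst hs
    rcases Nat.lt_or_ge s.card 2 with hlt | hge
    · rcases Nat.lt_or_ge s.card 1 with h0 | h1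
      · obtain rfl : s = ∅ := Finset.card_eq_zero.mp (by omega)
        simp [mem_coordCube]
      · obtain ⟨i, rfl⟩ := Finset.card_eq_one.mp (by omega : s.card = 1)
        rw [mem_coordCube]
        intro j hj
        exact hc i j fun h => hj (Finset.mem_image.mpr ⟨i, Finset.mem_univ _, h.symm⟩)
    · obtain ⟨i, hi, j, hj, hij⟩ := Finset.one_lt_card.mp hge
      refine mem_coordCube_of_adj (IH _ (Finset.card_erase_lt_of_mem hi) _ rfl)
        (IH _ (Finset.card_erase_lt_of_mem hj) _ rfl) (fun h => ?_) (hadj s i hi) (hadj s j hj)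
      have := hg h
      exact Finset.notMem_erase i s (this ▸ Finset.mem_erase.mpr ⟨hij, hi⟩)
  have himg : Finset.univ.image g ⊆ U := by
    intro z hz
    obtain ⟨s, -, rfl⟩ := Finset.mem_image.mp hz
    exact (e.symm (ind s)).2
  have hUcard : U.card = 2 ^ k := by
    have := Fintype.card_congr e.toEquiv
    simpa using this
  have hgcard : (Finset.univ.image g).card = 2 ^ k := by
    rw [Finset.card_image_of_injective _ hg]
    simp
  have hU : Finset.univ.image g = U := Finset.eq_of_subset_of_card_le himg (by omega)
  refine Finset.eq_of_subset_of_card_le ?_ ?_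
  · rw [← hU]
    intro z hz
    obtain ⟨s, -, rfl⟩ := Finset.mem_image.mp hz
    exact hmem s
  · rw [hUcard]
    refine (card_coordCube_le _ _).trans (Nat.pow_le_pow_right (by norm_num) ?_)
    exact Finset.card_image_le.trans (by simp)

theorem isSubcube_coordCube (p : Fin n → Bool) (R : Finset (Fin n)) :
    IsSubcube n R.card (coordCube p R) := by
  classical
  let r : Fin R.card ≃ R := R.equivFin.symm
  refine ⟨⟨⟨fun z i => z.1 (r i), fun w => ⟨fun i => if h : i ∈ R then w (r.symm ⟨i, h⟩) else p i,
    ?_⟩, ?_, ?_⟩, ?_⟩⟩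
  · rw [Finset.mem_coe, mem_coordCube]
    intro i hi
    simp [hi]
  · intro z
    have hz := mem_coordCube.mp (Finset.mem_coe.mp z.2)
    refine Subtype.ext (funext fun i => ?_)
    by_cases hi : i ∈ R
    · simp [hi]
    · simp [hi, hz i hi]
  · intro w
    funext i
    simp
  · intro z w
    have hz := mem_coordCube.mp (Finset.mem_coe.mp z.2)
    have hw := mem_coordCube.mp (Finset.mem_coe.mp w.2)
    rw [SimpleGraph.induce_adj, hypercube_adj_iff, hypercube_adj_iff]
    simp only [Equiv.coe_fn_mk]
    constructor
    · rintro ⟨i, hi, h⟩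
      refine ⟨r i, hi, fun j hj => ?_⟩
      by_cases hjR : j ∈ R
      · have := h (r.symm ⟨j, hjR⟩) (fun hc => hj (by rw [← hc]; simp))
        simpa using this
      · rw [hz j hjR, hw j hjR]
    · rintro ⟨i, hi, h⟩
      have hiR : i ∈ R := by
        by_contra hc
        exact hi (by rw [hz i hc, hw i hc])
      refine ⟨r.symm ⟨i, hiR⟩, by simpa using hi, fun j hj => h _ fun hc => hj ?_⟩
      rw [Equiv.eq_symm_apply]
      exact Subtype.ext hc

end Subcubes

/-! ### Distances after removing few subcubes. -/

section UpperBound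

variable {n : ℕ}

/-- The point of the cube differing from `x` exactly at the coordinates in `S`. -/
def flipOn (x : Fin n → Bool) (S : Finset (Fin n)) : Fin n → Bool :=
  fun i => if i ∈ S then !x i else x i

/-- Outside `R` the flips are forced to be those turning `x` into `p`, and inside `R` they are free,
so a coordinate cube becomes an interval. -/
lemma flipOn_mem_coordCube {x p : Fin n → Bool} {R S : Finset (Fin n)} :
    flipOn x S ∈ coordCube p R ↔
      (Finset.univ.filter fun i => i ∉ R ∧ x i ≠ p i) ⊆ S ∧
        S ⊆ Finset.univ.filter fun i => i ∈ R ∨ x i ≠ p i := by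
  rw [mem_coordCube]
  constructor
  · intro h
    constructor
    · intro i hi
      simp only [Finset.mem_filter, Finset.mem_univ, true_and] at hi
      by_contra hc
      have := h i hi.1
      simp only [flipOn, hc, if_false] at this
      exact hi.2 this
    · intro i hi
      simp only [Finset.mem_filter, Finset.mem_univ, true_and]
      by_contra! hc
      have := h i hc.1
      simp only [flipOn, hi, if_true, hc.2] at this
      exact Bool.not_ne_self _ this
  · rintro ⟨h1, h2⟩ i hi
    by_cases hS : i ∈ S
    · have := h2 hS
      simp only [Finset.mem_filter, Finset.mem_univ, true_and] at this
      have := this.resolve_left hi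
      simp only [flipOn, hS, if_true]
      revert this
      cases x i <;> cases p i <;> simp
    · by_contra hc
      refine hS (h1 ?_)
      simp only [flipOn, hS, if_false] at hc
      simp [hi, hc]

lemma hypercube_adj_flipOn_insert (x : Fin n → Bool) {S : Finset (Fin n)} {a : Fin n}
    (ha : a ∉ S) : (hypercube n).Adj (flipOn x S) (flipOn x (insert a S)) := by
  refine hypercube_adj_iff.mpr ⟨a, ?_, fun j hj => ?_⟩
  · simp [flipOn, ha]
  · simp [flipOn, hj]

/-- A saturated chain avoiding the removed vertices bounds the distance of its ends. -/
lemma edist_le_of_chain {F : Finset (Finset (Fin n → Bool))} {P : Finset (Fin n) → Prop}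
    {x : Fin n → Bool} (hP : ∀ S, P S → ∀ U ∈ F, flipOn x S ∉ U) {S T : Finset (Fin n)}
    (h : Relation.ReflTransGen (StepUp P) S T) (hS : ∀ U ∈ F, flipOn x S ∉ U)
    (hT : ∀ U ∈ F, flipOn x T ∉ U) :
    (removeFamily n F).edist ⟨flipOn x S, hS⟩ ⟨flipOn x T, hT⟩ + S.card ≤ T.card := by
  induction h with
  | refl => simp
  | @tail V W _ hVW ih =>
    obtain ⟨hV, -, a, ha, rfl⟩ := hVW
    have hadj : (removeFamily n F).Adj ⟨flipOn x V, hP V hV⟩ ⟨flipOn x (insert a V), hT⟩ :=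
      hypercube_adj_flipOn_insert x ha
    rw [Finset.card_insert_of_notMem ha, Nat.cast_add, Nat.cast_one]
    calc _ ≤ ((removeFamily n F).edist ⟨flipOn x S, hS⟩ ⟨flipOn x V, hP V hV⟩ + 1) + S.card := by
          gcongr
          rw [← SimpleGraph.edist_eq_one_iff_adj.mpr hadj]
          exact SimpleGraph.edist_triangle
      _ = ((removeFamily n F).edist ⟨flipOn x S, hS⟩ ⟨flipOn x V, hP V hV⟩ + S.card) + 1 := by
          ring
      _ ≤ _ := by
          gcongr
          exact ih _

/-- Removing fewer than `n - m` subcubes of dimension at most `m` leaves any two vertices at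
distance at most `n + 1`. -/
theorem edist_removeFamily_le {m : ℕ} {F : Finset (Finset (Fin n → Bool))}
    (hF : ∀ U ∈ F, ∃ k ≤ m, IsSubcube n k U) (hcard : F.card + m + 1 ≤ n)
    (x y : {x : Fin n → Bool | ∀ U ∈ F, x ∉ U}) :
    (removeFamily n F).edist x y ≤ ((n + 1 : ℕ) : ℕ∞) := by
  classical
  -- Membership sits inside the existential so that `choose` yields total functions; the values off
  -- `F` are irrelevant.
  have hF' : ∀ U : Finset (Fin n → Bool), ∃ (p : Fin n → Bool) (R : Finset (Fin n)),
      U ∈ F → R.card ≤ m ∧ U = coordCube p R := by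
    intro U
    by_cases hU : U ∈ F
    · obtain ⟨k, hk, h⟩ := hF U hU
      obtain ⟨p, R, hR, rfl⟩ := h.exists_eq_coordCube
      exact ⟨p, R, fun _ => ⟨hR.trans hk, rfl⟩⟩
    · exact ⟨fun _ => false, ∅, fun h => absurd h hU⟩
  choose p R hpR using hF'
  obtain ⟨x, hx⟩ := x
  obtain ⟨y, hy⟩ := y
  let A : Finset (Fin n → Bool) → Finset (Fin n) := fun U =>
    Finset.univ.filter fun i => i ∉ R U ∧ x i ≠ p U i
  let B : Finset (Fin n → Bool) → Finset (Fin n) := fun U =>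
    Finset.univ.filter fun i => i ∈ R U ∨ x i ≠ p U i
  let D : Finset (Fin n) := Finset.univ.filter fun i => x i ≠ y i
  have hav : ∀ S, Avoids A B F S ↔ ∀ U ∈ F, flipOn x S ∉ U := by
    intro S
    refine forall₂_congr fun U hU => not_congr ?_
    conv_rhs => rw [(hpR U hU).2]
    exact flipOn_mem_coordCube.symm
  have hx0 : flipOn x ∅ = x := by
    funext i
    simp [flipOn]
  have hyD : flipOn x D = y := by
    funext i
    by_cases h : x i = y i
    · simp [flipOn, D, h]
    · simp only [flipOn, D, Finset.mem_filter, Finset.mem_univ, true_and]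
      rw [if_pos h]
      revert h
      cases x i <;> cases y i <;> simp
  have hcD : D.card + Dᶜ.card = n := by
    rw [Finset.card_add_card_compl, Fintype.card_fin]
  obtain ⟨T, hTJ, hT, c1, c2, c3⟩ := exists_detour_avoiding A B
    (fun U i hi => by
      simp only [A, B, Finset.mem_filter, Finset.mem_univ, true_and] at hi ⊢
      exact .inr hi.2) F (D := D) (J := Dᶜ) disjoint_compl_right
    ((hav _).mpr (by rwa [hx0])) ((hav _).mpr (by rwa [hyD]))
    (fun U _ i _ => by simp)
    (fun U hU => by
      have hsub : (B U ∩ (D ∪ Dᶜ)) \ A U ⊆ R U := by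
        intro i
        simp only [A, B, Finset.mem_sdiff, Finset.mem_inter, Finset.mem_filter, Finset.mem_univ,
          true_and]
        tauto
      have h1 := Finset.card_le_card hsub
      have h2 := (hpR U hU).1
      omega)
  have hDT : Disjoint D T := disjoint_compl_right.mono_right hTJ
  have hP : ∀ S, Avoids A B F S → ∀ U ∈ F, flipOn x S ∉ U := fun S => (hav S).mp
  have gT : Avoids A B F T := by
    rcases Relation.ReflTransGen.cases_tail c1 with h | ⟨_, -, h⟩
    · rw [h]
      exact (hav _).mpr (by rwa [hx0])
    · exact h.2.1
  have gDT : Avoids A B F (D ∪ T) := by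
    rcases Relation.ReflTransGen.cases_tail c2 with h | ⟨_, -, h⟩
    · rw [h]
      exact gT
    · exact h.2.1
  have hx' : ∀ U ∈ F, flipOn x ∅ ∉ U := by rwa [hx0]
  have hy' : ∀ U ∈ F, flipOn x D ∉ U := by rwa [hyD]
  have e1 := edist_le_of_chain hP c1 hx' (hP _ gT)
  have e2 := edist_le_of_chain hP c2 (hP _ gT) (hP _ gDT)
  have e3 := edist_le_of_chain hP c3 hy' (hP _ gDT)
  rw [SimpleGraph.edist_comm] at e3
  have t1 : (removeFamily n F).edist ⟨flipOn x ∅, hx'⟩ ⟨flipOn x D, hy'⟩ ≤ _ + _ :=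
    SimpleGraph.edist_triangle (v := ⟨flipOn x (D ∪ T), hP _ gDT⟩)
  have t2 : (removeFamily n F).edist ⟨flipOn x ∅, hx'⟩ ⟨flipOn x (D ∪ T), hP _ gDT⟩ ≤ _ + _ :=
    SimpleGraph.edist_triangle (v := ⟨flipOn x T, hP _ gT⟩)
  have hxy : (removeFamily n F).edist ⟨x, hx⟩ ⟨y, hy⟩ =
      (removeFamily n F).edist ⟨flipOn x ∅, hx'⟩ ⟨flipOn x D, hy'⟩ := by
    simp only [hx0, hyD]
  rw [hxy]
  refine t1.trans ((add_le_add_left t2 _).trans ?_)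
  rw [Finset.card_union_of_disjoint hDT] at e2 e3
  generalize (removeFamily n F).edist ⟨flipOn x ∅, hx'⟩ ⟨flipOn x T, hP _ gT⟩ = a at e1 ⊢
  generalize (removeFamily n F).edist ⟨flipOn x T, hP _ gT⟩ ⟨flipOn x (D ∪ T), hP _ gDT⟩ = b
    at e2 ⊢
  generalize (removeFamily n F).edist ⟨flipOn x (D ∪ T), hP _ gDT⟩ ⟨flipOn x D, hy'⟩ = c at e3 ⊢
  have fin : ∀ (a : ℕ∞) (k l : ℕ), a + k ≤ l → ∃ a' : ℕ, a = a' ∧ a' + k ≤ l := by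
    intro a k l h
    have hne : a ≠ ⊤ := by
      rintro rfl
      simp at h
    lift a to ℕ using hne
    exact ⟨a, rfl, by exact_mod_cast h⟩
  obtain ⟨a, rfl, e1⟩ := fin _ _ _ e1
  obtain ⟨b, rfl, e2⟩ := fin _ _ _ e2
  obtain ⟨c, rfl, e3⟩ := fin _ _ _ e3
  -- The three legs cost at most `|T|`, `|D|` and `|T|`.
  norm_cast
  simp only [Finset.card_empty] at e1
  omega

end UpperBound

/-! ### Extremal families around an `m`-dimensional cube. -/

section Extremal

/-- The `m`-cube obtained from the one on the first `m` coordinates by moving in direction `i`. -/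
def shiftedCube (n m : ℕ) (i : Fin n) : Finset (Fin n → Bool) :=
  coordCube (fun j => decide (j = i)) (Finset.univ.filter fun j => j.1 < m)

variable {n m : ℕ}

lemma mem_shiftedCube {i : Fin n} {z : Fin n → Bool} :
    z ∈ shiftedCube n m i ↔ ∀ j : Fin n, m ≤ j.1 → z j = decide (j = i) := by
  simp [shiftedCube, mem_coordCube]

lemma isSubcubeFamily_image_shiftedCube {S : Finset (Fin n)}
    (hS : ∀ i ∈ S, m ≤ i.1) : IsSubcubeFamily n m (S.image (shiftedCube n m)) := by
  constructor
  · intro U hU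
    obtain ⟨i, -, rfl⟩ := Finset.mem_image.mp hU
    refine ⟨_, ?_, isSubcube_coordCube _ _⟩
    rw [Fin.card_filter_val_lt]
    exact min_le_right _ _
  · intro U hU W hW hne
    obtain ⟨i, hi, rfl⟩ := Finset.mem_image.mp hU
    obtain ⟨j, hj, rfl⟩ := Finset.mem_image.mp hW
    refine Finset.disjoint_left.mpr fun z hz hz' => hne ?_
    have h1 := mem_shiftedCube.mp hz i (hS i hi)
    have h2 := mem_shiftedCube.mp hz' i (hS i hi)
    rw [h1] at h2
    have : i = j := by simpa using h2
    rw [this]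

lemma notMem_image_shiftedCube {S : Finset (Fin n)} {z : Fin n → Bool} :
    (∀ U ∈ S.image (shiftedCube n m), z ∉ U) ↔ ∀ i ∈ S, z ∉ shiftedCube n m i := by
  simp

lemma notMem_shiftedCube_of_low {i : Fin n} {z : Fin n → Bool} (hi : m ≤ i.1)
    (hz : ∀ j : Fin n, m ≤ j.1 → z j = false) : z ∉ shiftedCube n m i := fun h => by
  have := mem_shiftedCube.mp h i hi
  rw [hz i hi] at this
  simp at this

lemma notMem_shiftedCube_of_two {i a b : Fin n} {z : Fin n → Bool} (ha : m ≤ a.1) (hb : m ≤ b.1)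
    (hab : a ≠ b) (hza : z a = true) (hzb : z b = true) : z ∉ shiftedCube n m i := fun h => by
  have h1 := mem_shiftedCube.mp h a ha
  have h2 := mem_shiftedCube.mp h b hb
  rw [hza] at h1
  rw [hzb] at h2
  exact hab ((of_decide_eq_true h1.symm).trans (of_decide_eq_true h2.symm).symm)

/-- Leaving the cube on the first `m` coordinates means entering one of the shifted cubes. -/
lemma exists_mem_shiftedCube_of_adj {z w : Fin n → Bool} (h : (hypercube n).Adj z w)
    (hz : ∀ j : Fin n, m ≤ j.1 → z j = false) (hw : ¬ ∀ j : Fin n, m ≤ j.1 → w j = false) :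
    ∃ i : Fin n, m ≤ i.1 ∧ w ∈ shiftedCube n m i ∧ w i = true ∧ ∀ j, j ≠ i → z j = w j := by
  obtain ⟨i, hi, h⟩ := hypercube_adj_iff.mp h
  push Not at hw
  obtain ⟨k, hk, hwk⟩ := hw
  have hki : k = i := by
    by_contra hc
    rw [← h k hc] at hwk
    exact hwk (hz k hk)
  subst hki
  have hwk' : w k = true := by simpa using hwk
  refine ⟨k, hk, mem_shiftedCube.mpr fun j hj => ?_, hwk', h⟩
  by_cases hjk : j = k
  · simp [hjk, hwk']
  · rw [← h j hjk, hz j hj]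
    simp [hjk]

lemma card_filter_le_val (n m : ℕ) :
    (Finset.univ.filter fun j : Fin n => m ≤ j.1).card = n - m := by
  have h := Finset.card_filter_add_card_filter_not (s := (Finset.univ : Finset (Fin n)))
    (fun j => j.1 < m)
  simp only [not_lt, Fin.card_filter_val_lt, Finset.card_univ, Fintype.card_fin] at h
  omega

theorem exists_disconnecting_family (hmn : m + 2 ≤ n) :
    ∃ F, IsSubcubeFamily n m F ∧ ¬ (removeFamily n F).Preconnected ∧ F.card ≤ n - m := by
  classical
  set S : Finset (Fin n) := Finset.univ.filter fun j => m ≤ j.1 with hS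
  have hSm : ∀ i ∈ S, m ≤ i.1 := fun i hi => (Finset.mem_filter.mp hi).2
  refine ⟨S.image (shiftedCube n m), isSubcubeFamily_image_shiftedCube hSm, ?_,
    Finset.card_image_le.trans (card_filter_le_val n m).le⟩
  intro hcon
  have h0 : ∀ U ∈ S.image (shiftedCube n m), (fun _ => false : Fin n → Bool) ∉ U :=
    notMem_image_shiftedCube.mpr fun i hi => notMem_shiftedCube_of_low (hSm i hi) fun _ _ => rfl
  have h1 : ∀ U ∈ S.image (shiftedCube n m), (fun _ => true : Fin n → Bool) ∉ U :=
    notMem_image_shiftedCube.mpr fun i hi => notMem_shiftedCube_of_two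
      (a := ⟨m, by omega⟩) (b := ⟨m + 1, by omega⟩) (by simp) (by simp) (by simp) rfl rfl
  have hreach := (SimpleGraph.reachable_iff_reflTransGen _ _).mp (hcon ⟨_, h0⟩ ⟨_, h1⟩)
  -- Every exit from the base cube enters a removed translate, so a path from `0` stays inside it.
  have hinv : ∀ v, Relation.ReflTransGen (removeFamily n (S.image (shiftedCube n m))).Adj
      ⟨_, h0⟩ v → ∀ j : Fin n, m ≤ j.1 → v.1 j = false := by
    intro v hv
    induction hv with
    | refl => exact fun _ _ => rfl
    | @tail u v _ huv ih =>
      by_contra hc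
      obtain ⟨i, hi, hmem, -⟩ := exists_mem_shiftedCube_of_adj huv ih hc
      exact v.2 _ (Finset.mem_image_of_mem _ (by simp [hS, hi])) hmem
  simpa using hinv _ hreach ⟨m, by omega⟩ le_rfl

/-- A potential that falls by at most one per edge bounds distance from below; unreachable pairs
have distance `⊤`. -/
lemma le_add_edist_of_lipschitz {V : Type*} {G : SimpleGraph V} (h : V → ℕ)
    (hh : ∀ u v, G.Adj u v → h u ≤ h v + 1) (u v : V) : (h u : ℕ∞) ≤ h v + G.edist u v := by
  by_cases hr : G.Reachable u v
  · obtain ⟨p, hp⟩ := hr.exists_walk_length_eq_edist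
    rw [← hp]
    norm_cast
    clear hp hr
    induction p with
    | nil => simp
    | cons hadj p ih =>
      have := hh _ _ hadj
      rw [SimpleGraph.Walk.length_cons]
      omega
  · rw [SimpleGraph.edist_eq_top_of_not_reachable hr]
    simp

theorem exists_family_ediam_ge (hmn : m + 3 ≤ n) :
    ∃ F, IsSubcubeFamily n m F ∧ F.card < n - m ∧
      ((n + 1 : ℕ) : ℕ∞) ≤ (removeFamily n F).ediam := by
  classical
  set e : Fin n := ⟨m, by omega⟩ with he
  set S : Finset (Fin n) := (Finset.univ.filter fun j => m ≤ j.1).erase e with hS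
  have hSm : ∀ i ∈ S, m ≤ i.1 := fun i hi =>
    (Finset.mem_filter.mp (Finset.mem_of_mem_erase hi)).2
  have hcard : S.card + 1 = n - m := by
    rw [hS, Finset.card_erase_add_one (by simp [he]), card_filter_le_val]
  refine ⟨S.image (shiftedCube n m), isSubcubeFamily_image_shiftedCube hSm,
    Finset.card_image_le.trans_lt (by omega), ?_⟩
  let y : Fin n → Bool := fun j => decide (j ≠ e)
  let low : (Fin n → Bool) → Prop := fun z => ∀ j : Fin n, m ≤ j.1 → z j = false
  have h0 : ∀ U ∈ S.image (shiftedCube n m), (fun _ => false : Fin n → Bool) ∉ U :=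
    notMem_image_shiftedCube.mpr fun i hi => notMem_shiftedCube_of_low (hSm i hi) fun _ _ => rfl
  have h1 : ∀ U ∈ S.image (shiftedCube n m), y ∉ U :=
    notMem_image_shiftedCube.mpr fun i hi => notMem_shiftedCube_of_two
      (a := ⟨m + 1, by omega⟩) (b := ⟨m + 2, by omega⟩) (by simp) (by simp) (by simp)
      (by simp [y, he]) (by simp [y, he])
  have hylow : ¬ low y := fun h => by
    have := h ⟨m + 1, by omega⟩ (by simp)
    simp [y, he] at this
  -- The extra `2` charges a vertex of the base cube for flipping `e` on the way out and back again
  -- later.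
  let pot : {x : Fin n → Bool | ∀ U ∈ S.image (shiftedCube n m), x ∉ U} → ℕ := fun z =>
    hammingDist z.1 y + if low z.1 then 2 else 0
  have hpot : ∀ u v, (removeFamily n (S.image (shiftedCube n m))).Adj u v →
      pot u ≤ pot v + 1 := by
    rintro ⟨u, hu⟩ ⟨v, hv⟩ huv
    have hd : hammingDist u v = 1 := huv
    have htri := hammingDist_triangle u v y
    by_cases hul : low u
    · by_cases hvl : low v
      · simp only [pot, hul, hvl, if_true]
        omega
      · obtain ⟨i, hi, hmem, hvi, hrest⟩ := exists_mem_shiftedCube_of_adj (z := u) (w := v) huv hul hvl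
        have hie : i = e := by
          by_contra hc
          exact hv _ (Finset.mem_image_of_mem _ (by simp [hS, hi, hc])) hmem
        subst hie
        -- The only open exit flips `e` away from its value in `y`, so the rise in Hamming distance
        -- absorbs half of the lost `2`.
        have hlt : hammingDist u y < hammingDist v y := by
          refine Finset.card_lt_card ((Finset.ssubset_iff_of_subset fun j hj => ?_).mpr
            ⟨e, ?_, ?_⟩)
          · rw [Finset.mem_filter] at hj ⊢
            refine ⟨hj.1, ?_⟩
            have hje : j ≠ e := by
              rintro rfl
              refine hj.2 ?_
              rw [hul e hi]
              simp [y]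
            rw [← hrest j hje]
            exact hj.2
          · simp [y, hvi]
          · simp [y, hul e hi]
        simp only [pot, hul, hvl, if_true, if_false]
        omega
    · simp only [pot, hul, if_false]
      omega
  have hpy : pot ⟨y, h1⟩ = 0 := by
    simp [pot, hylow]
  have hp0 : pot ⟨_, h0⟩ = n + 1 := by
    have hd : hammingDist (fun _ => false : Fin n → Bool) y = n - 1 := by
      have : (Finset.univ.filter fun i => (fun _ => false : Fin n → Bool) i ≠ y i) =
          Finset.univ.erase e := by
        ext i
        simp [y]
      rw [hammingDist, this, Finset.card_erase_of_mem (Finset.mem_univ _)]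
      simp
    have hl : low fun _ => false := fun _ _ => rfl
    simp only [pot, hd, hl, if_true]
    omega
  have := le_add_edist_of_lipschitz pot hpot ⟨_, h0⟩ ⟨y, h1⟩
  rw [hpy, hp0, Nat.cast_zero, zero_add] at this
  exact this.trans SimpleGraph.edist_le_ediam

end Extremal

theorem theorem3p25 (m n : ℕ) (hn : m + 3 ≤ n) :
    subcubeConnectivity n m = ((n - m : ℕ) : ℕ∞) ∧
      subcubeFaultDiam n m = ((n + 1 : ℕ) : ℕ∞) := by
  have hconn : subcubeConnectivity n m = ((n - m : ℕ) : ℕ∞) := by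
    refine le_antisymm ?_ (le_iInf₂ fun F hF => ?_)
    · obtain ⟨F, h1, h2, h3⟩ := exists_disconnecting_family (by omega : m + 2 ≤ n)
      exact (iInf₂_le F ⟨h1, h2⟩).trans (by exact_mod_cast h3)
    · norm_cast
      by_contra! hlt
      refine hF.2 fun x y => ?_
      have := edist_removeFamily_le hF.1.1 (by omega) x y
      exact SimpleGraph.edist_ne_top_iff_reachable.mp
        (ne_top_of_le_ne_top (ENat.natCast_ne_top _) this)
  refine ⟨hconn, le_antisymm (iSup₂_le fun F hF => ?_) ?_⟩
  · rw [hconn] at hF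
    have hlt : F.card < n - m := by exact_mod_cast hF.2
    exact SimpleGraph.ediam_le_of_edist_le fun x y =>
      edist_removeFamily_le hF.1.1 (by omega) x y
  · obtain ⟨F, h1, h2, h3⟩ := exists_family_ediam_ge hn
    refine h3.trans (le_iSup₂_of_le F ⟨h1, ?_⟩ le_rfl)
    rw [hconn]
    exact_mod_cast h2
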